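/- Theorem 2.6 (Characterization of all admissible configurations). Let $0<\theta<\pi/2$ and $\delta_\theta:=2\arccos\sqrt{\cos\theta}$. **Admissibility.** A deformation $y:\mathbb Z^2\to\mathbb R^3$ is *admissible* if $|y(x)-y(x')|=1$ whenever $|x-x'|=1$, and if for all $x\ne x''$ with $|x-x'|=|x''-x'|=1$ the angle at $y(x')$ between $y(x)-y(x')$ and $y(x'')-y(x')$ equals $\theta$ when $|x-x''|=\sqrt2$ (orthogonal bonds) and $\delta_\theta$ otherwise (opposite bonds). **Cells and forms.** For $q\in\mathbb Z^2$ put $y_1=y(q)$, $y_2=y(q+(1,0))$, $y_3=y(q+(1,1))$, $y_4=y(q+(0,1))$. The cell at $q$ is *optimal* if $|y_i-y_{i+1}|=1$ and the angle at $y_i$ in the triangle $y_{i-1},y_i,y_{i+1}$ is $\theta$ for all $i$ modulo $4$. It has *form* $\diagdown$ if $p\cdot n>0$ and *form* $\diagup$ if $p\cdot n<0$, where $p=\frac{y_1+y_3}2-\frac{y_2+y_4}2$ and $n=(y_2-y_1)\times(y_4-y_2)$. **4-tiles and types.** Let $v=\sqrt{(1-\cos\theta)/2}$, $s=\sqrt2\,v$,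 $h=\sqrt{1-2v^2}$. For $c\in\mathbb Z^2$, the 4-tile of $y$ with center $y(c)$ *has type* $\begin{pmatrix}a&b\\ c'&d\end{pmatrix}_{\pm}$, with $a,b,c',d\in\{\diagdown,\diagup\}$, if the four cells around $c$ are optimal, the upper left, upper right, lower left and lower right one having form $a,b,c',d$, respectively, and if some orientation-preserving isometry of $\mathbb R^3$ maps $y(c)$ to $0$ and $y(c+e_1),y(c+e_2),y(c-e_1),y(c-e_2)$ to $(s,0,\varsigma h),(0,s,\varsigma h),(-s,0,\varsigma h),(0,-s,\varsigma h)$, where $\varsigma=-1$ for the subscript $+$ and $\varsigma=1$ for the subscript $-$. Writing types as $[ab|c'd]_\pm$, set $$\mathcal A=\{[\diagup\diagdown|\diagdown\diagup]_+,\,[\diagdown\diagup|\diagup\diagdown]_-,\,[\diagup\diagup|\diagup\diagup]_-,\,[\diagdown\diagdown|\diagdown\diagdown]_+,\,[\diagdown\diagdown|\diagdown\diagup]_+,\,[\diagup\diagdown|\diagdown\diagdown]_+,\,[\diagdown\diagup|\diagup\diagup]_-,\,[\diagup\diagup|\diagup\diagdown]_-\}.$$ The first two are Z-tiles, the next two D-tiles,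 the last four I-tiles. **Type functions.** Let $S_1=(0,0)$, $S_2=(1,0)$, $S_3=(0,1)$, $S_4=(1,1)$. A function $\sigma_i$ on $2\mathbb Z^2$ is the *$i$-th type function* of $y$ if for every $(k,l)\in2\mathbb Z^2$ the 4-tile of $y$ with center $y(S_i+(k,l))$ has type $\sigma_i(k,l)$. A function $\sigma$ on $2\mathbb Z^2$ is said to satisfy (C) if for all $k,l\in2\mathbb Z$: $\sigma(k,l)\in\mathcal A$; $\sigma(k,l)=\sigma(k+2,l+2)$; and (M1) $\sigma(k,l)\in\{[\diagup\diagdown|\diagdown\diagup]_+,[\diagup\diagup|\diagup\diagup]_-,[\diagdown\diagdown|\diagdown\diagup]_+,[\diagdown\diagup|\diagup\diagup]_-\}$ if and only if $\sigma(k,l-2)\in\{[\diagup\diagdown|\diagdown\diagup]_+,[\diagup\diagup|\diagup\diagup]_-,[\diagup\diagdown|\diagdown\diagdown]_+,[\diagup\diagup|\diagup\diagdown]_-\}$; (M2) $\sigma(k,l)\in\{[\diagdown\diagup|\diagup\diagdown]_-,[\diagdown\diagdown|\diagdown\diagdown]_+,[\diagup\diagdown|\diagdown\diagdown]_+,[\diagup\diagup|\diagup\diagdown]_-\}$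 if and only if $\sigma(k,l-2)\in\{[\diagdown\diagup|\diagup\diagdown]_-,[\diagdown\diagdown|\diagdown\diagdown]_+,[\diagdown\diagdown|\diagdown\diagup]_+,[\diagdown\diagup|\diagup\diagup]_-\}$. **Claim.** (a) A deformation $y:\mathbb Z^2\to\mathbb R^3$ is admissible if and only if, for $r$ either the identity or the rotation $(a,b)\mapsto(-b,a)$ of $\mathbb Z^2$, the deformation $y\circ r$ has type functions $\sigma_1,\dots,\sigma_4$ and each of them satisfies (C). (b) Conversely, all such patterns occur: for every $i\in\{1,\dots,4\}$ and every function $\sigma$ on $2\mathbb Z^2$ satisfying (C) there is an admissible deformation whose $i$-th type function is $\sigma$ and whose four type functions all satisfy (C). -/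

import Mathlib

open scoped Matrix

noncomputable section

namespace NonflatTiling

/-- Three-dimensional Euclidean space. -/
abbrev R3 : Type := EuclideanSpace ℝ (Fin 3)

/-- A deformation of the reference lattice `ℤ²`. -/
abbrev Deformation : Type := ℤ × ℤ → R3

/-- Squared Euclidean distance of two points of the reference lattice. -/
def sqDist (x x' : ℤ × ℤ) : ℤ := (x.1 - x'.1) ^ 2 + (x.2 - x'.2) ^ 2

/-- The angle between opposite bonds, `δ_θ = 2 arccos √(cos θ)`. -/
def deltaTheta (θ : ℝ) : ℝ := 2 * Real.arccos (Real.sqrt (Real.cos θ))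

/-- Admissible deformations: nearest neighbours are mapped to points at distance one, and the
bond angle at `y x'` formed by two different nearest neighbours `x`, `x''` of `x'` is `θ` if `x` and
`x''` are next-to-nearest neighbours (orthogonal bonds), and `δ_θ` otherwise (opposite bonds). -/
structure IsAdmissible (θ : ℝ) (y : Deformation) : Prop where
  dist_eq : ∀ x x' : ℤ × ℤ, sqDist x x' = 1 → dist (y x) (y x') = 1
  angle_orthogonal : ∀ x x' x'' : ℤ × ℤ, sqDist x x' = 1 → sqDist x' x'' = 1 → x ≠ x'' →
    sqDist x x'' = 2 → EuclideanGeometry.angle (y x) (y x') (y x'') = θ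
  angle_opposite : ∀ x x' x'' : ℤ × ℤ, sqDist x x' = 1 → sqDist x' x'' = 1 → x ≠ x'' →
    sqDist x x'' ≠ 2 → EuclideanGeometry.angle (y x) (y x') (y x'') = deltaTheta θ

/-! ### Optimal cells and their forms -/

/-- The two forms of an optimal cell: `bs` is the form `╲`, `sl` is the form `╱`. -/
inductive Form : Type
  | bs
  | sl
  deriving DecidableEq

/-- The four points `y₁, y₂, y₃, y₄` form an optimal cell: unit sides, interior angles `θ`. -/
structure IsOptimalCell (θ : ℝ) (y₁ y₂ y₃ y₄ : R3) : Prop where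
  side₁₂ : dist y₁ y₂ = 1
  side₂₃ : dist y₂ y₃ = 1
  side₃₄ : dist y₃ y₄ = 1
  side₄₁ : dist y₄ y₁ = 1
  angle₁ : EuclideanGeometry.angle y₄ y₁ y₂ = θ
  angle₂ : EuclideanGeometry.angle y₁ y₂ y₃ = θ
  angle₃ : EuclideanGeometry.angle y₂ y₃ y₄ = θ
  angle₄ : EuclideanGeometry.angle y₃ y₄ y₁ = θ

/-- The number `p · n`, where `p = (y₁ + y₃) / 2 - (y₂ + y₄) / 2` and where
`n = (y₂ - y₁) × (y₄ - y₂)` is a normal vector of the triangle `y₁, y₂, y₄`. -/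
def kink (y₁ y₂ y₃ y₄ : R3) : ℝ :=
  ((1 / 2 : ℝ) • (y₁ + y₃) - (1 / 2 : ℝ) • (y₂ + y₄)).ofLp ⬝ᵥ
    (crossProduct (y₂ - y₁).ofLp (y₄ - y₂).ofLp)

/-- The cell has form `╲` if `p · n > 0`, and form `╱` if `p · n < 0`. -/
def HasForm (y₁ y₂ y₃ y₄ : R3) : Form → Prop
  | Form.bs => 0 < kink y₁ y₂ y₃ y₄
  | Form.sl => kink y₁ y₂ y₃ y₄ < 0

/-- The image under `y` of the reference cell with lower-left corner `q`, labelled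
counterclockwise from `q`, is an optimal cell of form `f`. -/
def CellHasForm (θ : ℝ) (y : Deformation) (q : ℤ × ℤ) (f : Form) : Prop :=
  IsOptimalCell θ (y q) (y (q + (1, 0))) (y (q + (1, 1))) (y (q + (0, 1))) ∧
    HasForm (y q) (y (q + (1, 0))) (y (q + (1, 1))) (y (q + (0, 1))) f

/-! ### 4-tiles and their types -/

/-- The symbol in the centre of the matrix notation of a 4-tile. -/
inductive Symb : Type
  | plus
  | minus
  deriving DecidableEq

/-- The symbol `+` stands for `ς = -1`, the symbol `-` for `ς = 1`. -/
def Symb.varsigma : Symb → ℝ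
  | Symb.plus => -1
  | Symb.minus => 1

/-- A type of 4-tiles: the forms of the upper-left, upper-right, lower-left and lower-right
optimal cell, and the symbol in the centre. -/
structure TileType : Type where
  ul : Form
  ur : Form
  ll : Form
  lr : Form
  symb : Symb
  deriving DecidableEq

/-- The type with symbol `+` and first row `a b`, second row `c d`. -/
def tileU (a b c d : Form) : TileType := ⟨a, b, c, d, Symb.plus⟩

/-- The type with symbol `-` and first row `a b`, second row `c d`. -/
def tileD (a b c d : Form) : TileType := ⟨a, b, c, d, Symb.minus⟩

/-- Half the length of the diagonals of an optimal cell. -/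
def vLen (θ : ℝ) : ℝ := Real.sqrt ((1 - Real.cos θ) / 2)

/-- `s = √2 v`. -/
def sLen (θ : ℝ) : ℝ := Real.sqrt 2 * vLen θ

/-- `h = √(1 - 2 v²)`. -/
def hLen (θ : ℝ) : ℝ := Real.sqrt (1 - 2 * vLen θ ^ 2)

/-- An orientation-preserving isometry `z ↦ Q (z - C)` brings the centre `C` and the middle points
`M₁, …, M₄` of a 4-tile to the reference position with parameter `ς`. -/
def InReferencePosition (θ ς : ℝ) (C M₁ M₂ M₃ M₄ : R3) : Prop :=
  ∃ Q ∈ Matrix.specialOrthogonalGroup (Fin 3) ℝ,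
    Q *ᵥ (M₁ - C).ofLp = ![sLen θ, 0, ς * hLen θ] ∧
    Q *ᵥ (M₂ - C).ofLp = ![0, sLen θ, ς * hLen θ] ∧
    Q *ᵥ (M₃ - C).ofLp = ![-sLen θ, 0, ς * hLen θ] ∧
    Q *ᵥ (M₄ - C).ofLp = ![0, -sLen θ, ς * hLen θ]

/-- The four cells of `y` around the lattice point `c` are optimal cells which form a (coplanar)
4-tile with centre `y c`, and this 4-tile has type `T`. -/
structure HasTileType (θ : ℝ) (y : Deformation) (c : ℤ × ℤ) (T : TileType) : Prop where
  upper_left : CellHasForm θ y (c - (1, 0)) T.ul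
  upper_right : CellHasForm θ y c T.ur
  lower_left : CellHasForm θ y (c - (1, 1)) T.ll
  lower_right : CellHasForm θ y (c - (0, 1)) T.lr
  reference : InReferencePosition θ T.symb.varsigma (y c)
    (y (c + (1, 0))) (y (c + (0, 1))) (y (c - (1, 0))) (y (c - (0, 1)))

/-- The offsets of the four tessellations of `ℤ²` by 4-tiles. -/
def offset : Fin 4 → ℤ × ℤ := ![(0, 0), (1, 0), (0, 1), (1, 1)]

/-- `σ` is the `i`-th type function of `y`. The type functions live on `2ℤ²`; the point
`(2 m, 2 n)` of `2ℤ²` is represented by `(m, n)`. -/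
def IsTypeFunction (θ : ℝ) (y : Deformation) (i : Fin 4) (σ : ℤ → ℤ → TileType) : Prop :=
  ∀ m n : ℤ, HasTileType θ y (offset i + (2 * m, 2 * n)) (σ m n)

open Form

/-- The class `𝒜` of eight Z-, D- and I-tiles. -/
def classA : Set TileType :=
  {tileU sl bs bs sl, tileD bs sl sl bs, tileD sl sl sl sl, tileU bs bs bs bs,
    tileU bs bs bs sl, tileU sl bs bs bs, tileD bs sl sl sl, tileD sl sl sl bs}

/-- The conditions on a type function (on `2ℤ²`, with `(2 m, 2 n)` represented by `(m, n)`):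
values in the class `𝒜`, constancy along the diagonal `(1, 1)`, and the two matching conditions
between vertically neighbouring 4-tiles. -/
structure IsMatching (σ : ℤ → ℤ → TileType) : Prop where
  mem_classA : ∀ m n : ℤ, σ m n ∈ classA
  diagonal : ∀ m n : ℤ, σ m n = σ (m + 1) (n + 1)
  matching₁ : ∀ m n : ℤ,
    σ m n ∈ ({tileU sl bs bs sl, tileD sl sl sl sl, tileU bs bs bs sl, tileD bs sl sl sl} :
        Set TileType) ↔
      σ m (n - 1) ∈ ({tileU sl bs bs sl, tileD sl sl sl sl, tileU sl bs bs bs,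
        tileD sl sl sl bs} : Set TileType)
  matching₂ : ∀ m n : ℤ,
    σ m n ∈ ({tileD bs sl sl bs, tileU bs bs bs bs, tileU sl bs bs bs, tileD sl sl sl bs} :
        Set TileType) ↔
      σ m (n - 1) ∈ ({tileD bs sl sl bs, tileU bs bs bs bs, tileU bs bs bs sl,
        tileD bs sl sl sl} : Set TileType)

/-- The rotation of the reference lattice by `π / 2`. -/
def latticeRot (x : ℤ × ℤ) : ℤ × ℤ := (-x.2, x.1)

end NonflatTiling

end

/-!
Write `c = cos θ` and let `b₁, b₂, b₃, b₄` be the bonds at a vertex of an admissible deformation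
`y`, in cyclic order. The angle `δ_θ` satisfies `cos δ_θ = 2 c - 1`, and the resulting inner
products force `b₁ + b₃ = b₂ + b₄` (`IsStar.add_opposite`), so that `y` solves the discrete wave
equation. Therefore the rising diagonal `y (q + (1, 1)) - y q` of a cell `q` depends on `q₁ + q₂`
only, and the falling diagonal `y (q + (0, 1)) - y (q + (1, 0))` on `q₁ - q₂` only. The two diagonals
of one cell are orthogonal, and so are those of neighbouring cells; by translation, all rising
diagonals are orthogonal to all falling ones (`inner_risingDiag_fallingDiag`). In dimension three
one of the two families then consists of parallel vectors, and by a rotation of the lattice it may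
be assumed to be the rising one. Parallel rising diagonals are even equal, to `a` say.

What is left is a one-dimensional problem: `y` is invariant under `(1, 1)` up to the translation by
`a`, and `y (m + 1, n) = y (m, n) + a / 2 + E (m - n)` for the edges `E d` of a planar polygon
orthogonal to `a`, with edges of fixed length and with turning angles that are fixed up to their sign
(`IsCorrugated`). The sign of the turn from `E (d - 1)` to `E d` is the form `F d` of the cells with
`m - n = d`, and the sequence `F` is arbitrary. The 4-tile at `(m, n)` with `d = m - n` has the type
`[F (d - 1), F d | F d, F (d + 1)]`, with the symbol `+` if and only if `F d` is `╲`
(`IsCorrugated.hasTileType`).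
These are precisely the eight types of the class `classA`, and the matching conditions say that the
types at `d` and `d + 2` agree about `F (d + 1)`. So type functions with these conditions are the
same as sequences `F` (`isMatching_typeOf`, `exists_typeOf_eq`).

Conversely, the cells and the reference position of a 4-tile contain all bond lengths and all bond
angles at its center (`HasTileType.isStarAt`), and each lattice point is the center of a 4-tile of
one of the four tessellations.
-/

namespace NonflatTiling

open Form

/-! ### Inner products and triple products -/

theorem inner_eq_coord (x y : R3) : inner ℝ x y = x 0 * y 0 + x 1 * y 1 + x 2 * y 2 := by
  simp [PiLp.inner_apply, Fin.sum_univ_three, mul_comm]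

/-- The triple product `x · (y × z)`. -/
def triple (x y z : R3) : ℝ := x.ofLp ⬝ᵥ crossProduct y.ofLp z.ofLp

theorem triple_eq_coord (x y z : R3) : triple x y z =
    x 0 * (y 1 * z 2 - y 2 * z 1) + x 1 * (y 2 * z 0 - y 0 * z 2) +
      x 2 * (y 0 * z 1 - y 1 * z 0) := by
  simp only [triple, cross_apply, Matrix.vec3_dotProduct, Matrix.cons_val]

/-- The square of a triple product is a Gram determinant. -/
theorem triple_sq {x y z : R3} (hxy : inner ℝ x y = 0) (hxz : inner ℝ x z = 0) :
    triple x y z ^ 2 =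
      inner ℝ x x * (inner ℝ y y * inner ℝ z z - inner ℝ y z ^ 2) := by
  have key : triple x y z ^ 2 = inner ℝ x x * (inner ℝ y y * inner ℝ z z - inner ℝ y z ^ 2)
      - inner ℝ x y * (inner ℝ x y * inner ℝ z z - inner ℝ y z * inner ℝ x z)
      + inner ℝ x z * (inner ℝ x y * inner ℝ y z - inner ℝ y y * inner ℝ x z) := by
    simp only [triple_eq_coord, inner_eq_coord]
    ring
  rw [key, hxy, hxz]
  ring

theorem dist_eq_one_iff {x y : R3} : dist x y = 1 ↔ inner ℝ (x - y) (x - y) = 1 := by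
  rw [dist_eq_norm, real_inner_self_eq_norm_sq]
  constructor
  · intro h
    rw [h]
    norm_num
  · intro h
    exact (sq_eq_sq₀ (norm_nonneg _) zero_le_one).1 (by rw [h]; norm_num)

theorem inner_eq_cos_of_angle {x y z : R3} {t : ℝ} (hx : dist x y = 1) (hz : dist z y = 1)
    (h : EuclideanGeometry.angle x y z = t) : inner ℝ (x - y) (z - y) = Real.cos t := by
  rw [dist_eq_norm] at hx hz
  rw [← h, EuclideanGeometry.angle, InnerProductGeometry.cos_angle, vsub_eq_sub, vsub_eq_sub,
    hx, hz]
  simp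

theorem angle_eq_of_inner_eq_cos {x y z : R3} {t : ℝ} (hx : dist x y = 1) (hz : dist z y = 1)
    (h0 : 0 ≤ t) (h1 : t ≤ Real.pi) (h : inner ℝ (x - y) (z - y) = Real.cos t) :
    EuclideanGeometry.angle x y z = t := by
  rw [dist_eq_norm] at hx hz
  rw [EuclideanGeometry.angle, InnerProductGeometry.angle, vsub_eq_sub, vsub_eq_sub,
    hx, hz, h]
  simp [Real.arccos_cos h0 h1]

/-- The diagonals of a skew quadrilateral with equal sides are orthogonal. -/
theorem inner_diagonals_eq_zero {y₁ y₂ y₃ y₄ : R3} (h₁₂ : dist y₁ y₂ = 1) (h₂₃ : dist y₂ y₃ = 1)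
    (h₃₄ : dist y₃ y₄ = 1) (h₄₁ : dist y₄ y₁ = 1) : inner ℝ (y₃ - y₁) (y₄ - y₂) = 0 := by
  rw [dist_eq_one_iff] at h₁₂ h₂₃ h₃₄ h₄₁
  simp only [inner_eq_coord, PiLp.sub_apply] at *
  linarith

/-! ### Trigonometric constants -/

section Constants

variable {θ : ℝ}

theorem cos_deltaTheta (h : 0 ≤ Real.cos θ) : Real.cos (deltaTheta θ) = 2 * Real.cos θ - 1 := by
  rw [deltaTheta, Real.cos_two_mul, Real.cos_arccos, Real.sq_sqrt h]
  · linarith [Real.sqrt_nonneg (Real.cos θ)]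
  · exact Real.sqrt_le_one.2 (Real.cos_le_one θ)

theorem deltaTheta_nonneg : 0 ≤ deltaTheta θ :=
  mul_nonneg zero_le_two (Real.arccos_nonneg _)

theorem deltaTheta_le_pi : deltaTheta θ ≤ Real.pi := by
  have : Real.arccos (Real.sqrt (Real.cos θ)) ≤ Real.pi / 2 :=
    Real.arccos_le_pi_div_two.2 (Real.sqrt_nonneg _)
  rw [deltaTheta]
  linarith

theorem sLen_sq : sLen θ ^ 2 = 1 - Real.cos θ := by
  rw [sLen, vLen, mul_pow, Real.sq_sqrt zero_le_two, Real.sq_sqrt]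
  · ring
  · linarith [Real.cos_le_one θ]

theorem sLen_pos (h : Real.cos θ < 1) : 0 < sLen θ :=
  mul_pos (Real.sqrt_pos.2 zero_lt_two) (Real.sqrt_pos.2 (by linarith))

theorem hLen_eq : hLen θ = Real.sqrt (Real.cos θ) := by
  rw [hLen, vLen, Real.sq_sqrt]
  · congr 1
    ring
  · linarith [Real.cos_le_one θ]

theorem hLen_sq (h : 0 ≤ Real.cos θ) : hLen θ ^ 2 = Real.cos θ := by
  rw [hLen_eq, Real.sq_sqrt h]

theorem hLen_pos (h : 0 < Real.cos θ) : 0 < hLen θ := by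
  rw [hLen_eq]
  exact Real.sqrt_pos.2 h

end Constants

/-! ### Corrugated deformations -/

/-- The vectors `e'` and `e` are consecutive edges of a planar polygon orthogonal to `a`, and have
the lengths and the unoriented turning angle for which the four points `P`, `P + a / 2 + e`,
`P + a`, `P + a / 2 - e'` form an optimal cell. -/
structure IsFold (θ : ℝ) (a e' e : R3) : Prop where
  inner_axis : inner ℝ a a = 2 - 2 * Real.cos θ
  inner_axis_left : inner ℝ a e' = 0
  inner_axis_right : inner ℝ a e = 0
  inner_left : inner ℝ e' e' = (1 + Real.cos θ) / 2
  inner_right : inner ℝ e e = (1 + Real.cos θ) / 2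
  inner_left_right : inner ℝ e' e = (1 - 3 * Real.cos θ) / 2

/-- Deformations that are translation invariant in the lattice direction `(1, 1)` with period `a`,
so that the image is a prismatic surface over a planar polygon with edges `E d`. -/
structure IsCorrugated (θ : ℝ) (y : Deformation) (a : R3) (E : ℤ → R3) : Prop where
  add_diag : ∀ m n : ℤ, y (m + 1, n + 1) = y (m, n) + a
  add_right : ∀ m n : ℤ, y (m + 1, n) = y (m, n) + (1 / 2 : ℝ) • a + E (m - n)
  isFold : ∀ d, IsFold θ a (E (d - 1)) (E d)

/-- The symbol of a 4-tile in terms of the form of its upper right cell. -/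
def Form.symb : Form → Symb
  | bs => Symb.plus
  | sl => Symb.minus

/-- The value of `a · (E (d - 1) × E d)` for a corrugated deformation whose cells `(m, n)` with
`m - n = d` have form `f`. -/
noncomputable def Form.turn (θ : ℝ) (f : Form) : ℝ :=
  -f.symb.varsigma * ((2 - 2 * Real.cos θ) * hLen θ)

namespace IsFold

variable {θ : ℝ} {a e' e : R3}

theorem inner_comb (H : IsFold θ a e' e) (α β γ α' β' γ' : ℝ) :
    inner ℝ (α • a + β • e' + γ • e) (α' • a + β' • e' + γ' • e) =
      α * α' * (2 - 2 * Real.cos θ) + (β * β' + γ * γ') * ((1 + Real.cos θ) / 2) +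
        (β * γ' + γ * β') * ((1 - 3 * Real.cos θ) / 2) := by
  have h1 : inner ℝ e' a = 0 := by rw [real_inner_comm, H.inner_axis_left]
  have h2 : inner ℝ e a = 0 := by rw [real_inner_comm, H.inner_axis_right]
  have h3 : inner ℝ e e' = (1 - 3 * Real.cos θ) / 2 := by
    rw [real_inner_comm, H.inner_left_right]
  simp only [inner_add_left, inner_add_right, real_inner_smul_left, real_inner_smul_right,
    H.inner_axis, H.inner_axis_left, H.inner_axis_right, H.inner_left, H.inner_right,
    H.inner_left_right, h1, h2, h3]
  ring

theorem isOptimalCell (H : IsFold θ a e' e) (h0 : 0 ≤ θ) (hpi : θ ≤ Real.pi) (P : R3) :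
    IsOptimalCell θ P (P + (1 / 2 : ℝ) • a + e) (P + a) (P + (1 / 2 : ℝ) • a - e') := by
  -- the four sides, as combinations of `a`, `e'`, `e`
  have s₁₂ : P - (P + (1 / 2 : ℝ) • a + e) =
      (-1 / 2 : ℝ) • a + (0 : ℝ) • e' + (-1 : ℝ) • e := by module
  have s₂₁ : P + (1 / 2 : ℝ) • a + e - P =
      (1 / 2 : ℝ) • a + (0 : ℝ) • e' + (1 : ℝ) • e := by module
  have s₂₃ : P + (1 / 2 : ℝ) • a + e - (P + a) =
      (-1 / 2 : ℝ) • a + (0 : ℝ) • e' + (1 : ℝ) • e := by module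
  have s₃₂ : P + a - (P + (1 / 2 : ℝ) • a + e) =
      (1 / 2 : ℝ) • a + (0 : ℝ) • e' + (-1 : ℝ) • e := by module
  have s₃₄ : P + a - (P + (1 / 2 : ℝ) • a - e') =
      (1 / 2 : ℝ) • a + (1 : ℝ) • e' + (0 : ℝ) • e := by module
  have s₄₃ : P + (1 / 2 : ℝ) • a - e' - (P + a) =
      (-1 / 2 : ℝ) • a + (-1 : ℝ) • e' + (0 : ℝ) • e := by module
  have s₄₁ : P + (1 / 2 : ℝ) • a - e' - P =
      (1 / 2 : ℝ) • a + (-1 : ℝ) • e' + (0 : ℝ) • e := by module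
  have s₁₄ : P - (P + (1 / 2 : ℝ) • a - e') =
      (-1 / 2 : ℝ) • a + (1 : ℝ) • e' + (0 : ℝ) • e := by module
  have d₁₂ : dist P (P + (1 / 2 : ℝ) • a + e) = 1 := by
    rw [dist_eq_one_iff, s₁₂, H.inner_comb]
    ring
  have d₂₃ : dist (P + (1 / 2 : ℝ) • a + e) (P + a) = 1 := by
    rw [dist_eq_one_iff, s₂₃, H.inner_comb]
    ring
  have d₃₄ : dist (P + a) (P + (1 / 2 : ℝ) • a - e') = 1 := by
    rw [dist_eq_one_iff, s₃₄, H.inner_comb]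
    ring
  have d₄₁ : dist (P + (1 / 2 : ℝ) • a - e') P = 1 := by
    rw [dist_eq_one_iff, s₄₁, H.inner_comb]
    ring
  refine ⟨d₁₂, d₂₃, d₃₄, d₄₁, ?_, ?_, ?_, ?_⟩
  · refine angle_eq_of_inner_eq_cos d₄₁ (by rw [dist_comm, d₁₂]) h0 hpi ?_
    rw [s₄₁, s₂₁, H.inner_comb]
    ring
  · refine angle_eq_of_inner_eq_cos d₁₂ (by rw [dist_comm, d₂₃]) h0 hpi ?_
    rw [s₁₂, s₃₂, H.inner_comb]
    ring
  · refine angle_eq_of_inner_eq_cos d₂₃ (by rw [dist_comm, d₃₄]) h0 hpi ?_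
    rw [s₂₃, s₄₃, H.inner_comb]
    ring
  · refine angle_eq_of_inner_eq_cos d₃₄ (by rw [dist_comm, d₄₁]) h0 hpi ?_
    rw [s₃₄, s₁₄, H.inner_comb]
    ring

/-- The orientation of a fold is the only freedom: `a · (e' × e)` is determined up to its sign. -/
theorem exists_triple_eq_turn (H : IsFold θ a e' e) (hc : 0 ≤ Real.cos θ) :
    ∃ f : Form, triple a e' e = f.turn θ := by
  have hsq : triple a e' e ^ 2 = ((2 - 2 * Real.cos θ) * hLen θ) ^ 2 := by
    rw [triple_sq H.inner_axis_left H.inner_axis_right, H.inner_axis, H.inner_left, H.inner_right,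
      H.inner_left_right, mul_pow, hLen_sq hc]
    ring
  rcases sq_eq_sq_iff_eq_or_eq_neg.1 hsq with h | h
  · exact ⟨bs, by rw [h, Form.turn, Form.symb, Symb.varsigma]; ring⟩
  · exact ⟨sl, by rw [h, Form.turn, Form.symb, Symb.varsigma]; ring⟩

end IsFold

/-! ### Form and reference position from the orientation of a fold -/

section Cell

variable {θ : ℝ} {a e' e : R3}

/-- The form of a cell is the orientation of the fold. -/
theorem kink_eq_triple (P a e e' : R3) :
    kink P (P + (1 / 2 : ℝ) • a + e) (P + a) (P + (1 / 2 : ℝ) • a - e') =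
      triple a e' e / 2 := by
  simp only [triple_eq_coord, kink, cross_apply, Matrix.vec3_dotProduct, Matrix.cons_val,
    PiLp.sub_apply, PiLp.add_apply, PiLp.smul_apply, smul_eq_mul]
  ring

theorem hasForm_of_triple (hc0 : 0 < Real.cos θ) (hc1 : Real.cos θ < 1) {f : Form}
    (h : triple a e' e = f.turn θ) (P : R3) :
    HasForm P (P + (1 / 2 : ℝ) • a + e) (P + a) (P + (1 / 2 : ℝ) • a - e') f := by
  have hpos : 0 < (2 - 2 * Real.cos θ) * hLen θ := mul_pos (by linarith) (hLen_pos hc0)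
  cases f <;>
  · simp only [HasForm, kink_eq_triple, h, Form.turn, Form.symb, Symb.varsigma]
    linarith

theorem of_orthonormal_mem_specialOrthogonalGroup {x z : Fin 3 → ℝ} (hx : x ⬝ᵥ x = 1)
    (hz : z ⬝ᵥ z = 1) (hxz : x ⬝ᵥ z = 0) :
    Matrix.of ![x, z, crossProduct x z] ∈ Matrix.specialOrthogonalGroup (Fin 3) ℝ := by
  have hzx : z ⬝ᵥ x = 0 := by rw [dotProduct_comm, hxz]
  have hn : crossProduct x z ⬝ᵥ crossProduct x z = 1 := by
    rw [cross_dot_cross, hx, hz, hxz]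
    ring
  have h1 : x ⬝ᵥ crossProduct x z = 0 := dot_self_cross x z
  have h2 : z ⬝ᵥ crossProduct x z = 0 := dot_cross_self x z
  rw [Matrix.mem_specialOrthogonalGroup_iff, Matrix.mem_orthogonalGroup_iff]
  constructor
  · ext i j
    have hij : (Matrix.of ![x, z, crossProduct x z] *
        (Matrix.of ![x, z, crossProduct x z])ᵀ) i j =
        (![x, z, crossProduct x z] i) ⬝ᵥ (![x, z, crossProduct x z] j) := rfl
    rw [hij]
    fin_cases i <;> fin_cases j <;>
      simp [hx, hz, hxz, hzx, hn, h1, h2, dotProduct_comm (crossProduct x z)]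
  · change Matrix.det ![x, z, crossProduct x z] = 1
    rw [← triple_product_eq_det, triple_product_permutation, triple_product_permutation, hn]

theorem IsFold.inReferencePosition (H : IsFold θ a e' e) (hc1 : Real.cos θ < 1) {f : Form}
    (h : triple a e' e = f.turn θ) (P : R3) :
    InReferencePosition θ f.symb.varsigma P (P + (1 / 2 : ℝ) • a + e) (P + (1 / 2 : ℝ) • a - e')
      (P - (1 / 2 : ℝ) • a - e') (P - (1 / 2 : ℝ) • a + e) := by
  obtain ⟨k, hk⟩ : ∃ k : ℝ, 2 * k * sLen θ = 1 :=
    ⟨1 / (2 * sLen θ), by field_simp [(sLen_pos hc1).ne']⟩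
  have hk2 : 4 * k ^ 2 * (1 - Real.cos θ) = 1 := by
    rw [← sLen_sq, ← one_pow 2, ← hk]
    ring
  have hks : sLen θ = 2 * k * (1 - Real.cos θ) := by
    rw [← sLen_sq]
    linear_combination (-sLen θ) * hk
  -- the rows of the rotation: the diagonals of the 4-tile, normalized, and their cross product
  set x : R3 := k • a + k • e' + k • e with hx
  set z : R3 := k • a + (-k) • e' + (-k) • e with hz
  have dot : ∀ p q : R3, p.ofLp ⬝ᵥ q.ofLp = inner ℝ p q := fun p q => by
    rw [inner_eq_coord, Matrix.vec3_dotProduct]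
  have hxx : x.ofLp ⬝ᵥ x.ofLp = 1 := by
    rw [dot, hx, H.inner_comb]
    linear_combination hk2
  have hzz : z.ofLp ⬝ᵥ z.ofLp = 1 := by
    rw [dot, hz, H.inner_comb]
    linear_combination hk2
  have hxz : x.ofLp ⬝ᵥ z.ofLp = 0 := by
    rw [dot, hx, hz, H.inner_comb]
    ring
  have cross_comb : ∀ α β γ : ℝ, crossProduct x.ofLp z.ofLp ⬝ᵥ
      (α • a + β • e' + γ • e).ofLp = 2 * k ^ 2 * (β - γ) * triple a e' e := by
    intro α β γ
    simp only [hx, hz, triple_eq_coord, cross_apply, Matrix.vec3_dotProduct, Matrix.cons_val,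
      PiLp.add_apply, PiLp.smul_apply, smul_eq_mul]
    ring
  have image : ∀ α β γ : ℝ, Matrix.of ![x.ofLp, z.ofLp, crossProduct x.ofLp z.ofLp] *ᵥ
      (α • a + β • e' + γ • e).ofLp = ![sLen θ * (α + (β + γ) / 2),
        sLen θ * (α - (β + γ) / 2), (γ - β) * (f.symb.varsigma * hLen θ)] := by
    intro α β γ
    have h1 : x.ofLp ⬝ᵥ (α • a + β • e' + γ • e).ofLp = sLen θ * (α + (β + γ) / 2) := by
      rw [dot, hx, H.inner_comb, hks]
      ring
    have h2 : z.ofLp ⬝ᵥ (α • a + β • e' + γ • e).ofLp = sLen θ * (α - (β + γ) / 2) := by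
      rw [dot, hz, H.inner_comb, hks]
      ring
    have h3 : crossProduct x.ofLp z.ofLp ⬝ᵥ (α • a + β • e' + γ • e).ofLp =
        (γ - β) * (f.symb.varsigma * hLen θ) := by
      rw [cross_comb, h, Form.turn]
      linear_combination (γ - β) * (f.symb.varsigma * hLen θ) * hk2
    rw [← h1, ← h2, ← h3]
    ext i
    fin_cases i <;> rfl
  refine ⟨_, of_orthonormal_mem_specialOrthogonalGroup hxx hzz hxz, ?_, ?_, ?_, ?_⟩
  · rw [show P + (1 / 2 : ℝ) • a + e - P = (1 / 2 : ℝ) • a + (0 : ℝ) • e' + (1 : ℝ) • e by module,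
      image]
    congr 1 <;> [ring; (congr 1 <;> [ring; (congr 1; ring)])]
  · rw [show P + (1 / 2 : ℝ) • a - e' - P = (1 / 2 : ℝ) • a + (-1 : ℝ) • e' + (0 : ℝ) • e by
      module, image]
    congr 1 <;> [ring; (congr 1 <;> [ring; (congr 1; ring)])]
  · rw [show P - (1 / 2 : ℝ) • a - e' - P = (-1 / 2 : ℝ) • a + (-1 : ℝ) • e' + (0 : ℝ) • e by
      module, image]
    congr 1 <;> [ring; (congr 1 <;> [ring; (congr 1; ring)])]
  · rw [show P - (1 / 2 : ℝ) • a + e - P = (-1 / 2 : ℝ) • a + (0 : ℝ) • e' + (1 : ℝ) • e by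
      module, image]
    congr 1 <;> [ring; (congr 1 <;> [ring; (congr 1; ring)])]

end Cell

/-! ### The 4-tiles of a corrugated deformation -/

/-- The type in `classA` with forms `a`, `b`, `b`, `c`. -/
def tileOf (a b c : Form) : TileType := ⟨a, b, b, c, b.symb⟩

theorem tileOf_mem_classA (a b c : Form) : tileOf a b c ∈ classA := by
  cases a <;> cases b <;> cases c <;> simp [classA, tileOf, tileU, tileD, Form.symb]

theorem eq_tileOf_of_mem_classA {T : TileType} (h : T ∈ classA) : T = tileOf T.ul T.ur T.lr := by
  simp only [classA, Set.mem_insert_iff, Set.mem_singleton_iff] at h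
  rcases h with rfl | rfl | rfl | rfl | rfl | rfl | rfl | rfl <;> rfl

/-- The left-hand side of the first matching condition. -/
theorem tileOf_mem_matching₁_upper (a b c : Form) : tileOf a b c ∈
    ({tileU sl bs bs sl, tileD sl sl sl sl, tileU bs bs bs sl, tileD bs sl sl sl} :
      Set TileType) ↔ c = sl := by
  cases a <;> cases b <;> cases c <;> simp [tileOf, tileU, tileD, Form.symb]

/-- The right-hand side of the first matching condition. -/
theorem tileOf_mem_matching₁_lower (a b c : Form) : tileOf a b c ∈
    ({tileU sl bs bs sl, tileD sl sl sl sl, tileU sl bs bs bs, tileD sl sl sl bs} :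
      Set TileType) ↔ a = sl := by
  cases a <;> cases b <;> cases c <;> simp [tileOf, tileU, tileD, Form.symb]

/-- The left-hand side of the second matching condition. -/
theorem tileOf_mem_matching₂_upper (a b c : Form) : tileOf a b c ∈
    ({tileD bs sl sl bs, tileU bs bs bs bs, tileU sl bs bs bs, tileD sl sl sl bs} :
      Set TileType) ↔ c = bs := by
  cases a <;> cases b <;> cases c <;> simp [tileOf, tileU, tileD, Form.symb]

/-- The right-hand side of the second matching condition. -/
theorem tileOf_mem_matching₂_lower (a b c : Form) : tileOf a b c ∈
    ({tileD bs sl sl bs, tileU bs bs bs bs, tileU bs bs bs sl, tileD bs sl sl sl} :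
      Set TileType) ↔ a = bs := by
  cases a <;> cases b <;> cases c <;> simp [tileOf, tileU, tileD, Form.symb]

/-- The types of the 4-tiles with centers in `offset i + 2 ℤ²`, if `F d` is the form of the cells
`(m, n)` with `m - n = d`. -/
def typeOf (F : ℤ → Form) (i : Fin 4) (m n : ℤ) : TileType :=
  tileOf (F ((offset i).1 - (offset i).2 + 2 * (m - n) - 1))
    (F ((offset i).1 - (offset i).2 + 2 * (m - n)))
    (F ((offset i).1 - (offset i).2 + 2 * (m - n) + 1))

theorem isMatching_typeOf (F : ℤ → Form) (i : Fin 4) : IsMatching (typeOf F i) where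
  mem_classA _ _ := tileOf_mem_classA _ _ _
  diagonal m n := by simp only [typeOf, add_sub_add_right_eq_sub]
  matching₁ m n := by
    simp only [typeOf, tileOf_mem_matching₁_upper, tileOf_mem_matching₁_lower]
    rw [show (offset i).1 - (offset i).2 + 2 * (m - (n - 1)) - 1 =
      (offset i).1 - (offset i).2 + 2 * (m - n) + 1 by ring]
  matching₂ m n := by
    simp only [typeOf, tileOf_mem_matching₂_upper, tileOf_mem_matching₂_lower]
    rw [show (offset i).1 - (offset i).2 + 2 * (m - (n - 1)) - 1 =
      (offset i).1 - (offset i).2 + 2 * (m - n) + 1 by ring]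

/-- Every function with the matching property consists of the types belonging to some sequence of
forms: the forms in the centers of the tiles give every second term, and the matching conditions
say that neighbouring tiles agree about the terms in between. -/
theorem exists_typeOf_eq {τ : ℤ → ℤ → TileType} (h : IsMatching τ) (i : Fin 4) :
    ∃ F : ℤ → Form, typeOf F i = τ := by
  have hper : ∀ m n k : ℤ, τ (m + k) (n + k) = τ m n := by
    intro m n k
    have hp : Function.Periodic (fun k : ℤ => τ (m + k) (n + k)) 1 := fun k => by
      simp only
      rw [← add_assoc, ← add_assoc, ← h.diagonal]
    simpa using hp.int_mul_eq k
  have hτ : ∀ m n : ℤ, τ m n = τ (m - n) 0 := fun m n => by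
    simpa using hper (m - n) 0 n
  have hA : ∀ k : ℤ, τ k 0 = tileOf (τ k 0).ul (τ k 0).ur (τ k 0).lr := fun k =>
    eq_tileOf_of_mem_classA (h.mem_classA k 0)
  have hmatch : ∀ k : ℤ, (τ (k - 1) 0).lr = (τ k 0).ul := by
    intro k
    have h1 := h.matching₁ (k - 1) 0
    rw [hτ (k - 1) (0 - 1), hA (k - 1), show k - 1 - (0 - 1) = k by ring, hA k,
      tileOf_mem_matching₁_upper, tileOf_mem_matching₁_lower] at h1
    generalize (τ (k - 1) 0).lr = f at h1 ⊢
    generalize (τ k 0).ul = g at h1 ⊢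
    cases f <;> cases g <;> simp at h1 ⊢
  set o : ℤ := (offset i).1 - (offset i).2 with ho
  -- even steps from `o` are tile centers, odd steps lie between two tiles
  refine ⟨fun d => if (d - o) % 2 = 0 then (τ ((d - o) / 2) 0).ur else (τ ((d - o) / 2) 0).lr, ?_⟩
  funext m n
  rw [hτ m n, hA (m - n)]
  simp only [typeOf, ← ho]
  congr 1
  · rw [if_neg (by omega), show (o + 2 * (m - n) - 1 - o) / 2 = m - n - 1 by omega, hmatch]
  · rw [if_pos (by omega), show (o + 2 * (m - n) - o) / 2 = m - n by omega]
  · rw [if_neg (by omega), show (o + 2 * (m - n) + 1 - o) / 2 = m - n by omega]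

namespace IsCorrugated

variable {θ : ℝ} {y : Deformation} {a : R3} {E : ℤ → R3}

theorem add_up (H : IsCorrugated θ y a E) (m n : ℤ) :
    y (m, n + 1) = y (m, n) + (1 / 2 : ℝ) • a - E (m - n - 1) := by
  have h := H.add_right m (n + 1)
  rw [H.add_diag, sub_add_eq_sub_sub] at h
  rw [eq_sub_of_add_eq h]
  module

theorem sub_right (H : IsCorrugated θ y a E) (m n : ℤ) :
    y (m - 1, n) = y (m, n) - (1 / 2 : ℝ) • a - E (m - n - 1) := by
  have h := H.add_right (m - 1) n
  rw [sub_add_cancel, sub_right_comm] at h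
  rw [h]
  module

theorem sub_up (H : IsCorrugated θ y a E) (m n : ℤ) :
    y (m, n - 1) = y (m, n) - (1 / 2 : ℝ) • a + E (m - n) := by
  have h := H.add_up m (n - 1)
  rw [sub_add_cancel, show m - (n - 1) - 1 = m - n by ring] at h
  rw [h]
  module

theorem cellHasForm (H : IsCorrugated θ y a E) (h0 : 0 ≤ θ) (hpi : θ ≤ Real.pi)
    (hc0 : 0 < Real.cos θ) (hc1 : Real.cos θ < 1) {m n : ℤ} {f : Form}
    (hf : triple a (E (m - n - 1)) (E (m - n)) = f.turn θ) : CellHasForm θ y (m, n) f := by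
  simp only [CellHasForm, Prod.mk_add_mk, add_zero, H.add_diag, H.add_right, H.add_up]
  exact ⟨(H.isFold _).isOptimalCell h0 hpi _, hasForm_of_triple hc0 hc1 hf _⟩

theorem hasTileType (H : IsCorrugated θ y a E) (h0 : 0 ≤ θ) (hpi : θ ≤ Real.pi)
    (hc0 : 0 < Real.cos θ) (hc1 : Real.cos θ < 1) {F : ℤ → Form}
    (hF : ∀ d, triple a (E (d - 1)) (E d) = (F d).turn θ) (m n : ℤ) :
    HasTileType θ y (m, n) (tileOf (F (m - n - 1)) (F (m - n)) (F (m - n + 1))) where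
  upper_left := by
    rw [Prod.mk_sub_mk, sub_zero]
    exact H.cellHasForm h0 hpi hc0 hc1 (by rw [hF, sub_right_comm]; rfl)
  upper_right := H.cellHasForm h0 hpi hc0 hc1 (hF _)
  lower_left := by
    rw [Prod.mk_sub_mk]
    exact H.cellHasForm h0 hpi hc0 hc1 (by rw [hF, sub_sub_sub_cancel_right]; rfl)
  lower_right := by
    rw [Prod.mk_sub_mk, sub_zero]
    exact H.cellHasForm h0 hpi hc0 hc1 (by rw [hF, sub_sub_eq_add_sub, add_sub_right_comm]; rfl)
  reference := by
    simp only [Prod.mk_add_mk, Prod.mk_sub_mk, add_zero, sub_zero, H.add_right, H.add_up,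
      H.sub_right, H.sub_up]
    exact (H.isFold _).inReferencePosition hc1 (hF _) _

theorem isTypeFunction (H : IsCorrugated θ y a E) (h0 : 0 ≤ θ) (hpi : θ ≤ Real.pi)
    (hc0 : 0 < Real.cos θ) (hc1 : Real.cos θ < 1) {F : ℤ → Form}
    (hF : ∀ d, triple a (E (d - 1)) (E d) = (F d).turn θ) (i : Fin 4) :
    IsTypeFunction θ y i (typeOf F i) := by
  intro m n
  have h := H.hasTileType h0 hpi hc0 hc1 hF ((offset i).1 + 2 * m) ((offset i).2 + 2 * n)
  rwa [show (offset i).1 + 2 * m - ((offset i).2 + 2 * n) =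
    (offset i).1 - (offset i).2 + 2 * (m - n) by ring] at h

end IsCorrugated

/-! ### Stars of bonds -/

/-- Inner products of the four bonds at a vertex of an admissible deformation, listed
counterclockwise in the reference lattice. -/
structure IsStar (θ : ℝ) (b₁ b₂ b₃ b₄ : R3) : Prop where
  inner₁₁ : inner ℝ b₁ b₁ = 1
  inner₂₂ : inner ℝ b₂ b₂ = 1
  inner₃₃ : inner ℝ b₃ b₃ = 1
  inner₄₄ : inner ℝ b₄ b₄ = 1
  inner₁₂ : inner ℝ b₁ b₂ = Real.cos θ
  inner₂₃ : inner ℝ b₂ b₃ = Real.cos θ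
  inner₃₄ : inner ℝ b₃ b₄ = Real.cos θ
  inner₄₁ : inner ℝ b₄ b₁ = Real.cos θ
  inner₁₃ : inner ℝ b₁ b₃ = 2 * Real.cos θ - 1
  inner₂₄ : inner ℝ b₂ b₄ = 2 * Real.cos θ - 1

/-- The bonds of `y` at the vertex `(m, n)` form a star. -/
def IsStarAt (θ : ℝ) (y : Deformation) (m n : ℤ) : Prop :=
  IsStar θ (y (m + 1, n) - y (m, n)) (y (m, n + 1) - y (m, n)) (y (m - 1, n) - y (m, n))
    (y (m, n - 1) - y (m, n))

namespace IsStar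

variable {θ : ℝ} {b₁ b₂ b₃ b₄ : R3}

theorem rotate (H : IsStar θ b₁ b₂ b₃ b₄) : IsStar θ b₂ b₃ b₄ b₁ where
  inner₁₁ := H.inner₂₂
  inner₂₂ := H.inner₃₃
  inner₃₃ := H.inner₄₄
  inner₄₄ := H.inner₁₁
  inner₁₂ := H.inner₂₃
  inner₂₃ := H.inner₃₄
  inner₃₄ := H.inner₄₁
  inner₄₁ := H.inner₁₂
  inner₁₃ := H.inner₂₄
  inner₂₄ := by rw [real_inner_comm, H.inner₁₃]

/-- The angle `δ_θ` is the one for which the star is a pyramid over a square. -/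
theorem add_opposite (H : IsStar θ b₁ b₂ b₃ b₄) : b₁ + b₃ = b₂ + b₄ := by
  have h₂₁ : inner ℝ b₂ b₁ = Real.cos θ := by rw [real_inner_comm, H.inner₁₂]
  have h₃₂ : inner ℝ b₃ b₂ = Real.cos θ := by rw [real_inner_comm, H.inner₂₃]
  have h₄₃ : inner ℝ b₄ b₃ = Real.cos θ := by rw [real_inner_comm, H.inner₃₄]
  have h₁₄ : inner ℝ b₁ b₄ = Real.cos θ := by rw [real_inner_comm, H.inner₄₁]
  have h₃₁ : inner ℝ b₃ b₁ = 2 * Real.cos θ - 1 := by rw [real_inner_comm, H.inner₁₃]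
  have h₄₂ : inner ℝ b₄ b₂ = 2 * Real.cos θ - 1 := by rw [real_inner_comm, H.inner₂₄]
  rw [← sub_eq_zero, ← inner_self_eq_zero (𝕜 := ℝ)]
  simp only [inner_sub_left, inner_sub_right, inner_add_left, inner_add_right, H.inner₁₁,
    H.inner₂₂, H.inner₃₃, H.inner₄₄, H.inner₁₂, H.inner₂₃, H.inner₃₄, H.inner₄₁, H.inner₁₃,
    H.inner₂₄, h₂₁, h₃₂, h₄₃, h₁₄, h₃₁, h₄₂]
  ring

/-- The polygon edges at a vertex, in terms of its star: `b₂ - b₃` is a rising diagonal. -/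
theorem isFold (H : IsStar θ b₁ b₂ b₃ b₄) :
    IsFold θ (b₂ - b₃) (-b₃ - (1 / 2 : ℝ) • (b₂ - b₃)) (b₁ - (1 / 2 : ℝ) • (b₂ - b₃)) := by
  have h₂₁ : inner ℝ b₂ b₁ = Real.cos θ := by rw [real_inner_comm, H.inner₁₂]
  have h₃₂ : inner ℝ b₃ b₂ = Real.cos θ := by rw [real_inner_comm, H.inner₂₃]
  have h₃₁ : inner ℝ b₃ b₁ = 2 * Real.cos θ - 1 := by rw [real_inner_comm, H.inner₁₃]
  constructor <;>
  · simp only [inner_sub_left, inner_sub_right, inner_neg_left, inner_neg_right,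
      real_inner_smul_left, real_inner_smul_right, H.inner₁₁, H.inner₂₂, H.inner₃₃, H.inner₁₂,
      H.inner₂₃, H.inner₁₃, h₂₁, h₃₂, h₃₁]
    ring

end IsStar

theorem eq_of_sqDist_eq_one {p q m n : ℤ} (h : sqDist (p, q) (m, n) = 1) :
    (p, q) = (m + 1, n) ∨ (p, q) = (m, n + 1) ∨ (p, q) = (m - 1, n) ∨ (p, q) = (m, n - 1) := by
  simp only [sqDist] at h
  have h1 : p - m ≤ 1 := by nlinarith [sq_nonneg (q - n)]
  have h2 : -1 ≤ p - m := by nlinarith [sq_nonneg (q - n)]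
  have h3 : q - n ≤ 1 := by nlinarith [sq_nonneg (p - m)]
  have h4 : -1 ≤ q - n := by nlinarith [sq_nonneg (p - m)]
  simp only [Prod.mk.injEq]
  obtain ⟨i, hi⟩ : ∃ i, i = p - m := ⟨_, rfl⟩
  obtain ⟨j, hj⟩ : ∃ j, j = q - n := ⟨_, rfl⟩
  rw [← hi] at h h1 h2
  rw [← hj] at h h3 h4
  interval_cases i <;> interval_cases j <;> omega

theorem sqDist_comm (x x' : ℤ × ℤ) : sqDist x x' = sqDist x' x := by
  simp only [sqDist]
  ring

/-- Admissibility in terms of inner products. -/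
theorem isAdmissible_iff_isStarAt {θ : ℝ} (h0 : 0 ≤ θ) (hpi : θ ≤ Real.pi)
    (hc : 0 ≤ Real.cos θ) (y : Deformation) :
    IsAdmissible θ y ↔ ∀ m n : ℤ, IsStarAt θ y m n := by
  constructor
  · intro H m n
    -- different neighbours of `(m, n)` have squared distance `2` or `4`
    have s₁ : sqDist (m + 1, n) (m, n) = 1 := by simp only [sqDist]; ring
    have s₂ : sqDist (m, n + 1) (m, n) = 1 := by simp only [sqDist]; ring
    have s₃ : sqDist (m - 1, n) (m, n) = 1 := by simp only [sqDist]; ring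
    have s₄ : sqDist (m, n - 1) (m, n) = 1 := by simp only [sqDist]; ring
    have orth : ∀ x z : ℤ × ℤ, sqDist x (m, n) = 1 → sqDist z (m, n) = 1 → sqDist x z = 2 →
        inner ℝ (y x - y (m, n)) (y z - y (m, n)) = Real.cos θ := fun x z hx hz hxz =>
      inner_eq_cos_of_angle (H.dist_eq _ _ hx) (H.dist_eq _ _ hz)
        (H.angle_orthogonal _ _ _ hx (sqDist_comm _ _ ▸ hz)
          (by rintro rfl; simp [sqDist] at hxz) hxz)
    have opp : ∀ x z : ℤ × ℤ, sqDist x (m, n) = 1 → sqDist z (m, n) = 1 → sqDist x z = 4 →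
        inner ℝ (y x - y (m, n)) (y z - y (m, n)) = 2 * Real.cos θ - 1 := fun x z hx hz hxz =>
      cos_deltaTheta hc ▸ inner_eq_cos_of_angle (H.dist_eq _ _ hx) (H.dist_eq _ _ hz)
        (H.angle_opposite _ _ _ hx (sqDist_comm _ _ ▸ hz)
          (by rintro rfl; simp [sqDist] at hxz) (by rw [hxz]; norm_num))
    exact ⟨dist_eq_one_iff.1 (H.dist_eq _ _ s₁), dist_eq_one_iff.1 (H.dist_eq _ _ s₂),
      dist_eq_one_iff.1 (H.dist_eq _ _ s₃), dist_eq_one_iff.1 (H.dist_eq _ _ s₄),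
      orth _ _ s₁ s₂ (by simp only [sqDist]; ring1), orth _ _ s₂ s₃ (by simp only [sqDist]; ring1),
      orth _ _ s₃ s₄ (by simp only [sqDist]; ring1), orth _ _ s₄ s₁ (by simp only [sqDist]; ring1),
      opp _ _ s₁ s₃ (by simp only [sqDist]; ring1), opp _ _ s₂ s₄ (by simp only [sqDist]; ring1)⟩
  · intro H
    have hdist : ∀ x x' : ℤ × ℤ, sqDist x x' = 1 → dist (y x) (y x') = 1 := by
      rintro ⟨p, q⟩ ⟨m, n⟩ h
      rw [dist_eq_one_iff]
      rcases eq_of_sqDist_eq_one h with h | h | h | h <;> rw [h]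
      exacts [(H m n).inner₁₁, (H m n).inner₂₂, (H m n).inner₃₃, (H m n).inner₄₄]
    have comm : ∀ {a b : R3} {t : ℝ}, inner ℝ a b = t → inner ℝ b a = t := fun h =>
      (real_inner_comm _ _).trans h
    refine ⟨hdist, ?_, ?_⟩
    · rintro ⟨p, q⟩ ⟨m, n⟩ ⟨p', q'⟩ h h' hne h2
      rw [sqDist_comm] at h'
      refine angle_eq_of_inner_eq_cos (hdist _ _ h) (hdist _ _ h') h0 hpi ?_
      have S := H m n
      rcases eq_of_sqDist_eq_one h with e | e | e | e <;>
        rcases eq_of_sqDist_eq_one h' with e' | e' | e' | e' <;>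
        rw [e, e'] at h2 hne ⊢ <;>
        first
        | exact absurd rfl hne
        | exact absurd ((show (4 : ℤ) = _ by simp only [sqDist]; ring1).trans h2) (by norm_num)
        | exact S.inner₁₂
        | exact S.inner₂₃
        | exact S.inner₃₄
        | exact S.inner₄₁
        | exact comm S.inner₁₂
        | exact comm S.inner₂₃
        | exact comm S.inner₃₄
        | exact comm S.inner₄₁
    · rintro ⟨p, q⟩ ⟨m, n⟩ ⟨p', q'⟩ h h' hne h2
      rw [sqDist_comm] at h'
      refine angle_eq_of_inner_eq_cos (hdist _ _ h) (hdist _ _ h') deltaTheta_nonneg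
        deltaTheta_le_pi ?_
      rw [cos_deltaTheta hc]
      have S := H m n
      rcases eq_of_sqDist_eq_one h with e | e | e | e <;>
        rcases eq_of_sqDist_eq_one h' with e' | e' | e' | e' <;>
        rw [e, e'] at h2 hne ⊢ <;>
        first
        | exact absurd rfl hne
        | exact absurd (by simp only [sqDist]; ring1) h2
        | exact S.inner₁₃
        | exact S.inner₂₄
        | exact comm S.inner₁₃
        | exact comm S.inner₂₄

theorem isStarAt_comp_latticeRot {θ : ℝ} {y : Deformation} {m n : ℤ} :
    IsStarAt θ (y ∘ latticeRot) m n ↔ IsStarAt θ y (-n) m := by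
  have e : IsStarAt θ (y ∘ latticeRot) m n ↔
      IsStar θ (y (-n, m + 1) - y (-n, m)) (y (-n - 1, m) - y (-n, m))
        (y (-n, m - 1) - y (-n, m)) (y (-n + 1, m) - y (-n, m)) := by
    simp only [IsStarAt, Function.comp_apply, latticeRot]
    rw [neg_add', neg_sub', sub_neg_eq_add]
  rw [e]
  exact ⟨fun h => h.rotate.rotate.rotate, fun h => h.rotate⟩

/-! ### Deformations with type functions are admissible -/

theorem mulVec_dotProduct_mulVec {Q : Matrix (Fin 3) (Fin 3) ℝ}
    (hQ : Q ∈ Matrix.specialOrthogonalGroup (Fin 3) ℝ) (u v : Fin 3 → ℝ) :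
    (Q *ᵥ u) ⬝ᵥ (Q *ᵥ v) = u ⬝ᵥ v := by
  have h := Matrix.mem_orthogonalGroup_iff' (Fin 3) ℝ |>.1 (Matrix.mem_specialOrthogonalGroup_iff.1 hQ).1
  rw [Matrix.dotProduct_mulVec, ← Matrix.mulVec_transpose, Matrix.mulVec_mulVec, h,
    Matrix.one_mulVec]

/-- Each cell of a 4-tile contributes one of the orthogonal angles at the center, and the reference
position determines the opposite angles. -/
theorem HasTileType.isStarAt {θ : ℝ} {y : Deformation} {m n : ℤ} {T : TileType}
    (H : HasTileType θ y (m, n) T) (hc : 0 ≤ Real.cos θ) : IsStarAt θ y m n := by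
  have hul := H.upper_left.1
  have hur := H.upper_right.1
  have hll := H.lower_left.1
  have hlr := H.lower_right.1
  have href := H.reference
  simp only [Prod.mk_add_mk, Prod.mk_sub_mk, add_zero, sub_zero, sub_add_cancel] at *
  obtain ⟨Q, hQ, q₁, q₂, q₃, q₄⟩ := href
  have hς : T.symb.varsigma ^ 2 = 1 := by cases T.symb <;> norm_num [Symb.varsigma]
  have d₁ : dist (y (m + 1, n)) (y (m, n)) = 1 := by rw [dist_comm, hur.side₁₂]
  have d₂ : dist (y (m, n + 1)) (y (m, n)) = 1 := hur.side₄₁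
  have d₃ : dist (y (m - 1, n)) (y (m, n)) = 1 := hul.side₁₂
  have d₄ : dist (y (m, n - 1)) (y (m, n)) = 1 := hll.side₂₃
  have opp : ∀ b b' : R3, Q *ᵥ b.ofLp ⬝ᵥ Q *ᵥ b'.ofLp = -sLen θ ^ 2 +
      T.symb.varsigma ^ 2 * hLen θ ^ 2 → inner ℝ b b' = 2 * Real.cos θ - 1 := by
    intro b b' h
    rw [mulVec_dotProduct_mulVec hQ, hς, sLen_sq, hLen_sq hc] at h
    rw [inner_eq_coord, ← Matrix.vec3_dotProduct, h]
    ring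
  refine ⟨dist_eq_one_iff.1 d₁, dist_eq_one_iff.1 d₂, dist_eq_one_iff.1 d₃,
    dist_eq_one_iff.1 d₄, ?_, ?_, ?_, ?_, ?_, ?_⟩
  · rw [real_inner_comm]
    exact inner_eq_cos_of_angle d₂ d₁ hur.angle₁
  · rw [real_inner_comm]
    exact inner_eq_cos_of_angle d₃ d₂ hul.angle₂
  · rw [real_inner_comm]
    exact inner_eq_cos_of_angle d₄ d₃ hll.angle₃
  · rw [real_inner_comm]
    exact inner_eq_cos_of_angle d₁ d₄ hlr.angle₄
  · refine opp _ _ ?_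
    rw [q₁, q₃, Matrix.vec3_dotProduct]
    simp only [Matrix.cons_val]
    ring
  · refine opp _ _ ?_
    rw [q₂, q₄, Matrix.vec3_dotProduct]
    simp only [Matrix.cons_val]
    ring

/-- The four tessellations contain a 4-tile around every lattice point. -/
theorem exists_offset_add_eq (m n : ℤ) :
    ∃ (i : Fin 4) (p q : ℤ), offset i + (2 * p, 2 * q) = (m, n) := by
  rcases Int.even_or_odd' m with ⟨p, rfl | rfl⟩ <;> rcases Int.even_or_odd' n with ⟨q, rfl | rfl⟩
  · exact ⟨0, p, q, by simp [offset]⟩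
  · exact ⟨2, p, q, by simp [offset, add_comm]⟩
  · exact ⟨1, p, q, by simp [offset, add_comm]⟩
  · exact ⟨3, p, q, by simp [offset, add_comm]⟩

theorem isStarAt_of_isTypeFunction {θ : ℝ} (hc : 0 ≤ Real.cos θ) {y : Deformation}
    {σ : Fin 4 → ℤ → ℤ → TileType} (H : ∀ i, IsTypeFunction θ y i (σ i)) (m n : ℤ) :
    IsStarAt θ y m n := by
  obtain ⟨i, p, q, h⟩ := exists_offset_add_eq m n
  have := H i p q
  rw [h] at this
  exact this.isStarAt hc

/-! ### Admissible deformations are corrugated -/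

/-- In three dimensions, two orthogonal families of vectors cannot both span planes. -/
theorem cross_eq_zero_or_cross_eq_zero {x x' z z' : Fin 3 → ℝ} (h₁ : x ⬝ᵥ z = 0)
    (h₂ : x ⬝ᵥ z' = 0) (h₃ : x' ⬝ᵥ z = 0) (h₄ : x' ⬝ᵥ z' = 0) :
    crossProduct x x' = 0 ∨ crossProduct z z' = 0 := by
  by_contra! H
  set M := crossProduct x x' with hM
  -- a vector orthogonal to `x` and `x'` is a multiple of `M`
  have hz : ∀ w : Fin 3 → ℝ, x ⬝ᵥ w = 0 → x' ⬝ᵥ w = 0 → (M ⬝ᵥ M) • w = (w ⬝ᵥ M) • M := by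
    intro w hw hw'
    have h : crossProduct w M = 0 := by
      rw [hM, cross_cross_eq_smul_sub_smul', hw, dotProduct_comm w, hw', zero_smul, zero_smul,
        sub_zero]
    have h' := cross_cross_eq_smul_sub_smul' M w M
    rw [h, map_zero] at h'
    exact (sub_eq_zero.1 h'.symm)
  have hzz : (M ⬝ᵥ M) • (M ⬝ᵥ M) • crossProduct z z' = 0 := by
    rw [← map_smul, ← LinearMap.map_smul₂, hz z h₁ h₃, hz z' h₂ h₄, map_smul,
      LinearMap.map_smul₂, cross_self, smul_zero, smul_zero]
  have hMM : M ⬝ᵥ M ≠ 0 := fun h => H.1 (dotProduct_self_eq_zero.1 h)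
  exact H.2 ((smul_eq_zero.1 ((smul_eq_zero.1 hzz).resolve_left hMM)).resolve_left hMM)

section Diagonals

variable {θ : ℝ} {y : Deformation}

/-- The diagonal of the cell with lower left corner `(m, n)` from the lower left to the upper right
corner. -/
def risingDiag (y : Deformation) (m n : ℤ) : R3 := y (m + 1, n + 1) - y (m, n)

/-- The diagonal of the cell with lower left corner `(m, n)` from the lower right to the upper left
corner. -/
def fallingDiag (y : Deformation) (m n : ℤ) : R3 := y (m, n + 1) - y (m + 1, n)

/-- An admissible deformation solves the discrete wave equation. -/
theorem add_horizontal_eq_add_vertical (S : ∀ m n, IsStarAt θ y m n) (m n : ℤ) :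
    y (m + 1, n) + y (m - 1, n) = y (m, n + 1) + y (m, n - 1) := by
  have h := (S m n).add_opposite
  rw [sub_add_sub_comm, sub_add_sub_comm] at h
  exact sub_left_injective h

theorem risingDiag_add_sub (S : ∀ m n, IsStarAt θ y m n) (m n k : ℤ) :
    risingDiag y (m + k) (n - k) = risingDiag y m n := by
  have hp : Function.Periodic (fun k : ℤ => risingDiag y (m + k) (n - k)) 1 := fun k => by
    have h := add_horizontal_eq_add_vertical S (m + k + 1) (n - k)
    rw [add_sub_cancel_right] at h
    simp only [risingDiag]
    rw [← add_assoc, ← sub_sub, sub_add_cancel, sub_eq_sub_iff_add_eq_add]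
    exact h
  simpa using hp.int_mul_eq k

theorem fallingDiag_add_add (S : ∀ m n, IsStarAt θ y m n) (m n k : ℤ) :
    fallingDiag y (m + k) (n + k) = fallingDiag y m n := by
  have hp : Function.Periodic (fun k : ℤ => fallingDiag y (m + k) (n + k)) 1 := fun k => by
    have h := add_horizontal_eq_add_vertical S (m + k + 1) (n + k + 1)
    rw [add_sub_cancel_right, add_sub_cancel_right] at h
    simp only [fallingDiag]
    rw [← add_assoc, ← add_assoc, sub_eq_sub_iff_add_eq_add, ← h, add_comm]
  simpa using hp.int_mul_eq k

theorem inner_risingDiag_fallingDiag_self (S : ∀ m n, IsStarAt θ y m n) (m n : ℤ) :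
    inner ℝ (risingDiag y m n) (fallingDiag y m n) = 0 := by
  have h₁ := (S m n).inner₁₁
  have h₂ := (S (m + 1) n).inner₂₂
  have h₃ := (S m (n + 1)).inner₁₁
  have h₄ := (S m n).inner₂₂
  rw [← dist_eq_one_iff] at h₁ h₂ h₃ h₄
  exact inner_diagonals_eq_zero (by rwa [dist_comm]) (by rwa [dist_comm]) h₃ h₄

theorem inner_risingDiag_fallingDiag_sub_one (S : ∀ m n, IsStarAt θ y m n) (m n : ℤ) :
    inner ℝ (risingDiag y (m - 1) n) (fallingDiag y m n) = 0 := by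
  have H : ∀ {b₁ b₂ b₃ b₄ : R3}, IsStar θ b₁ b₂ b₃ b₄ → inner ℝ (b₂ - b₃) (b₂ - b₁) = 0 := by
    intro b₁ b₂ b₃ b₄ H
    rw [inner_sub_left, inner_sub_right, inner_sub_right, H.inner₂₂, real_inner_comm, H.inner₁₂,
      real_inner_comm, H.inner₂₃, real_inner_comm, H.inner₁₃]
    ring
  have h := H (S m n)
  rw [risingDiag, fallingDiag, sub_add_cancel]
  rwa [sub_sub_sub_cancel_right, sub_sub_sub_cancel_right] at h

/-- All rising diagonals are orthogonal to all falling diagonals. By translation along the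
diagonals, both can be brought to one cell or to two neighbouring cells, depending on a parity. -/
theorem inner_risingDiag_fallingDiag (S : ∀ m n, IsStarAt θ y m n) (m n p q : ℤ) :
    inner ℝ (risingDiag y m n) (fallingDiag y p q) = 0 := by
  rcases Int.even_or_odd' (m + n - (p - q)) with ⟨k, hk | hk⟩
  · rw [← risingDiag_add_sub S m n (n - k), ← fallingDiag_add_add S p q (k - q),
      show m + (n - k) = p + (k - q) by linarith, show n - (n - k) = q + (k - q) by ring]
    exact inner_risingDiag_fallingDiag_self S _ _
  · rw [← risingDiag_add_sub S m n (n - (k + 1)), ← fallingDiag_add_add S p q (k + 1 - q),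
      show m + (n - (k + 1)) = p + (k + 1 - q) - 1 by linarith,
      show n - (n - (k + 1)) = q + (k + 1 - q) by ring]
    exact inner_risingDiag_fallingDiag_sub_one S _ _

/-- Parallel rising diagonals are equal, because those of neighbouring cells have the same inner
product with the common bond of the cells. -/
theorem risingDiag_eq_of_cross_eq_zero (hc1 : Real.cos θ < 1) (S : ∀ m n, IsStarAt θ y m n)
    (hpar : ∀ m n p q, crossProduct (risingDiag y m n).ofLp (risingDiag y p q).ofLp = 0)
    (m n : ℤ) : risingDiag y m n = risingDiag y 0 0 := by
  have step : ∀ m n, risingDiag y m n = risingDiag y (m - 1) n := by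
    intro m n
    set b : R3 := y (m, n + 1) - y (m, n) with hb
    have h1 : inner ℝ b (risingDiag y m n) = 1 - Real.cos θ := by
      have H := S m (n + 1)
      rw [IsStarAt, add_sub_cancel_right] at H
      have h : inner ℝ (-(y (m, n) - y (m, n + 1)))
          (y (m + 1, n + 1) - y (m, n + 1) - (y (m, n) - y (m, n + 1))) = 1 - Real.cos θ := by
        rw [inner_neg_left, inner_sub_right, H.inner₄₁, H.inner₄₄]
        ring
      rwa [neg_sub, sub_sub_sub_cancel_right] at h
    have h2 : inner ℝ b (risingDiag y (m - 1) n) = 1 - Real.cos θ := by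
      have H := S m n
      rw [risingDiag, sub_add_cancel, ← sub_sub_sub_cancel_right _ _ (y (m, n)),
        inner_sub_right, H.inner₂₂, H.inner₂₃]
    have h := cross_cross_eq_smul_sub_smul' b.ofLp (risingDiag y m n).ofLp
      (risingDiag y (m - 1) n).ofLp
    rw [inner_eq_coord, ← Matrix.vec3_dotProduct] at h1 h2
    rw [hpar, map_zero, dotProduct_comm _ b.ofLp, h1, h2, ← smul_sub] at h
    have h' := (smul_eq_zero.1 h.symm).resolve_left (by linarith)
    exact (WithLp.ofLp_injective 2) (sub_eq_zero.1 h')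
  have hcol : ∀ m n, risingDiag y m n = risingDiag y 0 n := by
    intro m n
    have hp : Function.Periodic (fun m : ℤ => risingDiag y m n) 1 := fun k => by
      simp only
      rw [step, add_sub_cancel_right]
    simpa using hp.int_mul_eq m
  have h := risingDiag_add_sub S 0 n n
  rw [hcol, hcol, sub_self] at h
  rw [hcol, h]

theorem exists_isCorrugated_of_cross_eq_zero (hc1 : Real.cos θ < 1)
    (S : ∀ m n, IsStarAt θ y m n)
    (hpar : ∀ m n p q, crossProduct (risingDiag y m n).ofLp (risingDiag y p q).ofLp = 0) :
    ∃ a E, IsCorrugated θ y a E := by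
  have hdiag := risingDiag_eq_of_cross_eq_zero hc1 S hpar
  set a := risingDiag y 0 0
  have hadd : ∀ m n, y (m + 1, n + 1) = y (m, n) + a := fun m n => by
    rw [← hdiag m n, risingDiag, add_sub_cancel]
  refine ⟨a, fun d => y (d + 1, 0) - y (d, 0) - (1 / 2 : ℝ) • a, hadd, ?_, ?_⟩
  · intro m n
    have hp : Function.Periodic (fun k : ℤ => y (m + k + 1, n + k) - y (m + k, n + k)) 1 :=
      fun k => by
        simp only
        rw [← add_assoc, ← add_assoc, hadd, hadd, add_sub_add_right_eq_sub]
    have h := hp.int_mul_eq (-n)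
    simp only [Int.cast_id, mul_one, add_neg_cancel, add_zero, ← sub_eq_add_neg] at h
    simp only [h]
    abel
  · intro d
    have H := (S d 0).isFold
    have ha : a = y (d, 0 + 1) - y (d, 0) - (y (d - 1, 0) - y (d, 0)) := by
      rw [sub_sub_sub_cancel_right, ← hdiag (d - 1) 0, risingDiag, sub_add_cancel]
    rw [← ha, neg_sub] at H
    simpa only [sub_add_cancel] using H

theorem exists_isCorrugated (hc1 : Real.cos θ < 1) (S : ∀ m n, IsStarAt θ y m n) :
    ∃ r : ℤ × ℤ → ℤ × ℤ, (r = id ∨ r = latticeRot) ∧ ∃ a E, IsCorrugated θ (y ∘ r) a E := by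
  by_cases hu : ∀ m n p q, crossProduct (risingDiag y m n).ofLp (risingDiag y p q).ofLp = 0
  · exact ⟨id, Or.inl rfl, exists_isCorrugated_of_cross_eq_zero hc1 S hu⟩
  · push Not at hu
    obtain ⟨m, n, p, q, hu⟩ := hu
    have dot : ∀ i j k l, (risingDiag y i j).ofLp ⬝ᵥ (fallingDiag y k l).ofLp = 0 := by
      intro i j k l
      rw [Matrix.vec3_dotProduct, ← inner_eq_coord, inner_risingDiag_fallingDiag S]
    have hw : ∀ i j k l, crossProduct (fallingDiag y i j).ofLp (fallingDiag y k l).ofLp = 0 :=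
      fun i j k l => (cross_eq_zero_or_cross_eq_zero (dot m n i j) (dot m n k l) (dot p q i j)
        (dot p q k l)).resolve_left hu
    have hrot : ∀ i j, risingDiag (y ∘ latticeRot) i j = fallingDiag y (-j - 1) i := by
      intro i j
      simp only [risingDiag, fallingDiag, Function.comp_apply, latticeRot, sub_add_cancel,
        neg_add']
    refine ⟨latticeRot, Or.inr rfl, exists_isCorrugated_of_cross_eq_zero hc1
      (fun i j => isStarAt_comp_latticeRot.2 (S _ _)) ?_⟩
    intro i j k l
    rw [hrot, hrot, hw]

end Diagonals

/-! ### Construction of corrugated deformations -/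

/-- Discrete primitives exist on `ℤ`. -/
theorem exists_add_one_eq_add {G : Type*} [AddCommGroup G] (f : ℤ → G) :
    ∃ g : ℤ → G, ∀ d, g (d + 1) = g d + f d := by
  let s : ℕ → G := fun n => ∑ i ∈ Finset.range n, f i
  let t : ℕ → G := fun n => -∑ i ∈ Finset.range n, f (-(i + 1 : ℕ))
  have ht : ∀ n, t n = t (n + 1) + f (-(n + 1 : ℕ)) := fun n => by
    simp only [t, Finset.sum_range_succ]
    abel
  refine ⟨fun d => if 0 ≤ d then s d.toNat else t (-d).toNat, fun d => ?_⟩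
  rcases lt_or_ge d 0 with hd | hd
  · obtain ⟨n, rfl⟩ : ∃ n : ℕ, d = -(n + 1 : ℕ) := ⟨(-d).toNat - 1, by omega⟩
    have h1 : (if 0 ≤ -((n + 1 : ℕ) : ℤ) + 1 then s (-((n + 1 : ℕ) : ℤ) + 1).toNat
        else t (-(-((n + 1 : ℕ) : ℤ) + 1)).toNat) = t n := by
      split_ifs with h
      · obtain rfl : n = 0 := by omega
        simp [s, t]
      · congr 1
        omega
    simp only
    rw [h1, if_neg (by omega), ht, neg_neg, Int.toNat_natCast]
  · obtain ⟨n, rfl⟩ := Int.eq_ofNat_of_zero_le hd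
    simp only
    rw [if_pos (by omega), if_pos hd, Int.toNat_natCast, Int.toNat_natCast_add_one]
    exact Finset.sum_range_succ _ _

/-- The turning angle at the vertices of the planar polygon: the edges have squared length
`(1 + cos θ) / 2`, and their inner product is `(1 - 3 cos θ) / 2`. -/
noncomputable def turnAngle (θ : ℝ) : ℝ :=
  Real.arccos ((1 - 3 * Real.cos θ) / (1 + Real.cos θ))

theorem cos_turnAngle {θ : ℝ} (hc0 : 0 ≤ Real.cos θ) (hc1 : Real.cos θ ≤ 1) :
    (1 + Real.cos θ) * Real.cos (turnAngle θ) = 1 - 3 * Real.cos θ := by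
  rw [turnAngle, Real.cos_arccos]
  · field_simp
  · rw [le_div_iff₀ (by linarith)]
    linarith
  · rw [div_le_iff₀ (by linarith)]
    linarith

theorem sin_turnAngle {θ : ℝ} (hc0 : 0 ≤ Real.cos θ) (hc1 : Real.cos θ ≤ 1) :
    Real.sqrt (2 - 2 * Real.cos θ) * ((1 + Real.cos θ) / 2) * Real.sin (turnAngle θ) =
      (2 - 2 * Real.cos θ) * hLen θ := by
  have hsin : 0 ≤ Real.sin (turnAngle θ) := Real.sin_nonneg_of_nonneg_of_le_pi
    (Real.arccos_nonneg _) (Real.arccos_le_pi _)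
  have hh : 0 ≤ hLen θ := Real.sqrt_nonneg _
  have h1 : 0 ≤ 2 - 2 * Real.cos θ := by linarith
  have h2 : 0 ≤ 1 + Real.cos θ := by linarith
  rw [← sq_eq_sq₀ (by positivity) (by positivity), mul_pow, mul_pow, mul_pow, Real.sq_sqrt h1,
    hLen_sq hc0, Real.sin_sq]
  linear_combination (-(2 - 2 * Real.cos θ) / 4) *
    ((1 + Real.cos θ) * Real.cos (turnAngle θ) + (1 - 3 * Real.cos θ)) * cos_turnAngle hc0 hc1

/-- Every sequence of forms occurs: turn left or right by the fixed turning angle at the vertices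
of a planar polygon, as prescribed by the forms. -/
theorem exists_isCorrugated_of_form {θ : ℝ} (hc0 : 0 ≤ Real.cos θ) (hc1 : Real.cos θ ≤ 1)
    (F : ℤ → Form) : ∃ y a E, IsCorrugated θ y a E ∧
      ∀ d, triple a (E (d - 1)) (E d) = (F d).turn θ := by
  obtain ⟨α, hα⟩ := exists_add_one_eq_add
    fun d : ℤ => -(F (d + 1)).symb.varsigma * turnAngle θ
  have hα' : ∀ d, α d - α (d - 1) = -(F d).symb.varsigma * turnAngle θ := fun d => by
    have h := hα (d - 1)
    rw [sub_add_cancel] at h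
    rw [h, add_sub_cancel_left]
  have hcos : ∀ d, Real.cos (α d - α (d - 1)) = Real.cos (turnAngle θ) := fun d => by
    rw [hα']
    cases F d <;> simp [Form.symb, Symb.varsigma]
  have hsin : ∀ d, Real.sin (α d - α (d - 1)) =
      -(F d).symb.varsigma * Real.sin (turnAngle θ) := fun d => by
    rw [hα']
    cases F d <;> simp [Form.symb, Symb.varsigma]
  set l : ℝ := Real.sqrt ((1 + Real.cos θ) / 2) with hl
  set p : ℝ := Real.sqrt (2 - 2 * Real.cos θ) with hp
  have hl2 : l ^ 2 = (1 + Real.cos θ) / 2 := Real.sq_sqrt (by linarith)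
  have hp2 : p ^ 2 = 2 - 2 * Real.cos θ := Real.sq_sqrt (by linarith)
  let a : R3 := !₂[0, 0, p]
  let E : ℤ → R3 := fun d => !₂[l * Real.cos (α d), l * Real.sin (α d), 0]
  have hEE : ∀ d, inner ℝ (E d) (E d) = (1 + Real.cos θ) / 2 := fun d => by
    simp only [inner_eq_coord, E, Matrix.cons_val]
    linear_combination hl2 + l ^ 2 * Real.sin_sq_add_cos_sq (α d)
  obtain ⟨Y, hY⟩ := exists_add_one_eq_add E
  refine ⟨fun x => ((x.1 + x.2 : ℝ) / 2) • a + Y (x.1 - x.2), a, E, ⟨?_, ?_, ?_⟩, ?_⟩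
  · intro m n
    simp only [add_sub_add_right_eq_sub]
    push_cast
    module
  · intro m n
    simp only [add_sub_right_comm m 1 n, hY]
    push_cast
    module
  · intro d
    refine ⟨?_, ?_, ?_, hEE _, hEE _, ?_⟩
    · simp only [inner_eq_coord, a, Matrix.cons_val]
      linear_combination hp2
    · simp [inner_eq_coord, a, E]
    · simp [inner_eq_coord, a, E]
    · have h := hcos d
      rw [Real.cos_sub] at h
      simp only [inner_eq_coord, E, Matrix.cons_val]
      linear_combination l ^ 2 * h + Real.cos (turnAngle θ) * hl2 + cos_turnAngle hc0 hc1 / 2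
  · intro d
    have h := hsin d
    rw [Real.sin_sub] at h
    simp only [triple_eq_coord, a, E, Matrix.cons_val, Form.turn]
    linear_combination p * l ^ 2 * h -
      p * (F d).symb.varsigma * Real.sin (turnAngle θ) * hl2 -
      (F d).symb.varsigma * sin_turnAngle hc0 hc1

end NonflatTiling

/-- Characterization of all admissible configurations: a deformation is admissible if and only if,
possibly after a rotation of the lattice by `π / 2`, its four type functions exist and satisfy the
conditions; and each type function satisfying the conditions is realized by an admissible
deformation. -/
theorem theorem2p6 (θ : ℝ) (hθ₀ : 0 < θ) (hθ : θ < Real.pi / 2) :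
    (∀ y : NonflatTiling.Deformation,
      NonflatTiling.IsAdmissible θ y ↔
        ∃ r : ℤ × ℤ → ℤ × ℤ, (r = id ∨ r = NonflatTiling.latticeRot) ∧
          ∃ σ : Fin 4 → ℤ → ℤ → NonflatTiling.TileType,
            ∀ i : Fin 4, NonflatTiling.IsTypeFunction θ (y ∘ r) i (σ i) ∧
              NonflatTiling.IsMatching (σ i)) ∧
    (∀ (i : Fin 4) (τ : ℤ → ℤ → NonflatTiling.TileType), NonflatTiling.IsMatching τ →
      ∃ y : NonflatTiling.Deformation, NonflatTiling.IsAdmissible θ y ∧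
        ∃ σ : Fin 4 → ℤ → ℤ → NonflatTiling.TileType, σ i = τ ∧
          ∀ j : Fin 4, NonflatTiling.IsTypeFunction θ y j (σ j) ∧
            NonflatTiling.IsMatching (σ j)) := by
  have hpi : θ ≤ Real.pi := by linarith [Real.pi_pos]
  have hc0 : 0 < Real.cos θ := Real.cos_pos_of_mem_Ioo ⟨by linarith, hθ⟩
  have hc1 : Real.cos θ < 1 := by
    rw [← Real.cos_zero]
    exact Real.cos_lt_cos_of_nonneg_of_le_pi le_rfl hpi hθ₀
  have star_iff := NonflatTiling.isAdmissible_iff_isStarAt hθ₀.le hpi hc0.le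
  refine ⟨fun y => ⟨fun hy => ?_, ?_⟩, fun i τ hτ => ?_⟩
  · obtain ⟨r, hr, a, E, H⟩ := NonflatTiling.exists_isCorrugated hc1 ((star_iff y).1 hy)
    choose F hF using fun d => (H.isFold d).exists_triple_eq_turn hc0.le
    exact ⟨r, hr, NonflatTiling.typeOf F, fun i =>
      ⟨H.isTypeFunction hθ₀.le hpi hc0 hc1 hF i, NonflatTiling.isMatching_typeOf F i⟩⟩
  · rintro ⟨r, hr, σ, H⟩
    have S := NonflatTiling.isStarAt_of_isTypeFunction hc0.le fun i => (H i).1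
    rw [star_iff]
    rcases hr with rfl | rfl
    · exact S
    · intro m n
      have h := NonflatTiling.isStarAt_comp_latticeRot.1 (S n (-m))
      rwa [neg_neg] at h
  · obtain ⟨F, rfl⟩ := NonflatTiling.exists_typeOf_eq hτ i
    obtain ⟨y, a, E, H, hF⟩ := NonflatTiling.exists_isCorrugated_of_form hc0.le hc1.le F
    have hT := H.isTypeFunction hθ₀.le hpi hc0 hc1 hF
    exact ⟨y, (star_iff y).2 (NonflatTiling.isStarAt_of_isTypeFunction hc0.le hT),
      NonflatTiling.typeOf F, rfl, fun j => ⟨hT j, NonflatTiling.isMatching_typeOf F j⟩⟩
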